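/- Let $G$ be a non-solvable generalized Baumslag–Solitar group, i.e. the fundamental group of a finite graph of groups with infinite cyclic vertex and edge groups. Let $T$ be a metric simplicial $G$-tree in its cyclic deformation space: $G$ acts minimally on $T$ by simplicial isometries without inversions, with finite quotient graph and infinite cyclic vertex and edge stabilizers. A cyclic factor of $G$ is a proper subgroup, not fixing a point of the Bass–Serre tree, that is conjugate to $\pi_1(\Gamma_H)$ for a connected subgraph $\Gamma_H$ of a finite graph of infinite cyclic groups $\Gamma$ with $\pi_1(\Gamma)\simeq G$; an automorphism $\phi$ of $G$ is fully irreducible if no power $\phi^k$, $k\ge 1$, preserves the conjugacy class of a cyclic factor. Let $\phi$ be fully irreducible and let $f:T\to T$ be a train track representative of $\phi$: $f(gx)=\phi(g)f(x)$ for all $g\in G$, $x\in T$; $f$ maps vertices to vertices and maps each edge linearly onto a non-degenerate non-backtracking path, with the same stretching factor $\lambda$ on all edges; calling two edges with the same origin equivalent (in the same gate) when their images under $f$ overlap in positive length, there are at least two gates at each vertex, and for every edge $e$ and every $k\in\mathbb N$ the path $f^k(e)$ crosses no turn whose two edges are in the same gate. Assume $\lambda\neq 1$. A path in $T$ is legal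 if it crosses no turn $\{e,e'\}$ such that $f^k(e)\cap f^k(e')$ is not a single point for some $k\in\mathbb N$. Then $f$ has bounded backtracking: there is a constant $B$ such that for all $x,y\in T$ the image $f([x,y])$ lies in the $B$-neighbourhood of $[f(x),f(y)]$. Moreover, let $\mathrm{BBT}(f)$ be any such constant and let $C_f:=\frac{2\,\mathrm{BBT}(f)}{\lambda-1}$. Then for every non-backtracking path $\alpha$ in $T$ (finite or infinite), every legal subpath $\beta\subset\alpha$ with $\operatorname{len}(\beta)>2C_f$, and every $n\in\mathbb N$, $$\operatorname{len}\bigl(f^n(\beta)\cap[f^n(\alpha)]\bigr)\ \ge\ \tfrac12\,\lambda^n\operatorname{len}(\beta),$$ where $[f^n(\alpha)]$ denotes the non-backtracking path with the same endpoints (possibly at infinity) as $f^n(\alpha)$. -/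

import Mathlib

open scoped ENNReal

universe u v

namespace GBS

/-! ### Metric simplicial trees, identified with their geometric realizations -/

section Tree

variable {T : Type v} [MetricSpace T]

/-- The segment `[x, y]`. In a tree this is the unique geodesic from `x` to `y`. -/
def seg (x y : T) : Set T := {z | dist x z + dist z y = dist x y}

/-- `γ` restricted to `I` is a geodesic parametrized by arc length. When `I` is an interval, of
any kind, bounded or not, `γ '' I` is a non-backtracking path of the tree. -/
def IsGeodesicOn (γ : ℝ → T) (I : Set ℝ) : Prop :=
  ∀ s ∈ I, ∀ t ∈ I, dist (γ s) (γ t) = |s - t|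

/-- `(v, w)` is an oriented edge for the vertex set `V`: two distinct vertices with no vertex
strictly between them. The edge itself, as a subset of the tree, is `seg v w`. -/
def IsEdge (V : Set T) (v w : T) : Prop :=
  v ∈ V ∧ w ∈ V ∧ v ≠ w ∧ ∀ z ∈ seg v w, z ∈ V → z = v ∨ z = w

/-- The metric space `T` is the geometric realization of a metric simplicial tree with vertex
set `V`: it is a real tree (geodesic and `0`-hyperbolic), a segment contains finitely many
vertices, each point is a vertex or lies on an edge, and distinct edges meet only in vertices. -/
structure IsMetricTree (V : Set T) : Prop where
  nonempty : V.Nonempty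
  geodesic : ∀ x y : T, ∃ γ : ℝ → T,
    γ 0 = x ∧ γ (dist x y) = y ∧ IsGeodesicOn γ (Set.Icc 0 (dist x y))
  hyperbolic : ∀ x y z w : T,
    dist x y + dist z w ≤ max (dist x z + dist y w) (dist x w + dist y z)
  finite_vertices : ∀ x y : T, (V ∩ seg x y).Finite
  cover : ∀ x : T, x ∈ V ∨ ∃ v w, IsEdge V v w ∧ x ∈ seg v w
  edges_meet : ∀ v w v' w' : T, IsEdge V v w → IsEdge V v' w' →
    ∀ x ∈ seg v w, x ∈ seg v' w' → x ∉ V → (v = v' ∧ w = w') ∨ (v = w' ∧ w = v')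

/-- A (simplicial) subtree: a nonempty convex subset which is a union of vertices and edges. -/
structure IsSubtree (V : Set T) (Y : Set T) : Prop where
  nonempty : Y.Nonempty
  convex : ∀ x ∈ Y, ∀ y ∈ Y, seg x y ⊆ Y
  subcomplex : ∀ v w, IsEdge V v w → ∀ x ∈ seg v w, x ∈ Y → x ∉ V → seg v w ⊆ Y

/-- The length of a subset of the tree that is a non-backtracking path, as its one-dimensional
Hausdorff measure. -/
noncomputable def len (S : Set T) : ℝ≥0∞ :=
  letI : MeasurableSpace T := borel T
  haveI : BorelSpace T := ⟨rfl⟩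
  MeasureTheory.Measure.hausdorffMeasure 1 S

/-- The tightened path `[η]` of a path `η : I → T` on an interval `I`: the non-backtracking path
with the same endpoints, as a subset of `T`. A point lies on it when it lies on
`[η a', η b']` for all sufficiently large compact subintervals `[a', b']` of `I`. For
`I = [a, b]` this is `[η a, η b]` (see `tighten_Icc`); for an infinite path converging to points
of the boundary it is the geodesic with these ends. -/
def tighten (η : ℝ → T) (I : Set ℝ) : Set T :=
  {p | ∃ a ∈ I, ∃ b ∈ I, a ≤ b ∧
    ∀ a' ∈ I, ∀ b' ∈ I, a' ≤ a → b ≤ b' → p ∈ seg (η a') (η b')}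

theorem tighten_Icc (η : ℝ → T) {a b : ℝ} (hab : a ≤ b) :
    tighten η (Set.Icc a b) = seg (η a) (η b) := by
  ext p
  constructor
  · rintro ⟨a₁, ha₁, b₁, hb₁, -, h⟩
    exact h a ⟨le_rfl, hab⟩ b ⟨hab, le_rfl⟩ ha₁.1 hb₁.2
  · intro hp
    refine ⟨a, ⟨le_rfl, hab⟩, b, ⟨hab, le_rfl⟩, hab, ?_⟩
    intro a' ha' b' hb' h1 h2
    rw [le_antisymm h1 ha'.1, le_antisymm hb'.2 h2]
    exact hp

/-- `B` is a bounded backtracking constant `BBT(f)`: for all `x, y` the image `f([x, y])` lies in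
the `B`-neighbourhood of `[f x, f y]`. -/
def IsBBT (f : T → T) (B : ℝ) : Prop :=
  ∀ x y, ∀ p ∈ seg x y, ∃ q ∈ seg (f x) (f y), dist (f p) q ≤ B

/-- The critical constant `C_f = 2 BBT(f) / (λ - 1)`. -/
noncomputable def criticalConstant (B lam : ℝ) : ℝ := 2 * B / (lam - 1)

/-! ### Gates and turns

An edge with origin `u` is given by its other endpoint, so a turn at `u` is given by `a, b` with
`IsEdge V u a` and `IsEdge V u b`. -/

/-- The gate structure induced by `f`: the equivalence relation on the edges with origin `u`
generated by the pairs of edges whose images overlap in nonzero length. (It is invariant under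
the group when `f` is equivariant.) -/
def InducedGate (V : Set T) (f : T → T) (u a b : T) : Prop :=
  Relation.EqvGen
    (fun a b => IsEdge V u a ∧ IsEdge V u b ∧ len (f '' seg u a ∩ f '' seg u b) ≠ 0) a b

/-- The train track structure: two edges with origin `u` are equivalent if for some `k` their
images under `f^k`, which share the point `f^k u`, do not meet in a single point. -/
def TrainTrackGate (f : T → T) (u a b : T) : Prop :=
  ∃ k : ℕ, ¬ (f^[k] '' seg u a ∩ f^[k] '' seg u b).Subsingleton

/-- The path `η : I → T` crosses the turn at `u` formed by the edges `seg u a` and `seg u b`: at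
some time it arrives at `u` along the first and immediately leaves along the second. -/
def CrossesTurn (η : ℝ → T) (I : Set ℝ) (u a b : T) : Prop :=
  ∃ s t r : ℝ, s < t ∧ t < r ∧ Set.Icc s r ⊆ I ∧ η t = u ∧
    (∀ x ∈ Set.Ico s t, η x ∈ seg u a ∧ η x ≠ u) ∧
    (∀ x ∈ Set.Ioc t r, η x ∈ seg u b ∧ η x ≠ u)

/-- The path `η : I → T` is legal: it crosses only legal turns for the train track structure. -/
def IsLegal (V : Set T) (f : T → T) (η : ℝ → T) (I : Set ℝ) : Prop :=
  ∀ u a b, IsEdge V u a → IsEdge V u b → CrossesTurn η I u a b → ¬ TrainTrackGate f u a b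

end Tree

/-! ### Cyclic splittings of a group `G` and the cyclic deformation space -/

/-- `T`, with vertex set `V`, is the Bass–Serre tree of a finite graph of groups with infinite
cyclic vertex and edge groups and fundamental group `G`: a metric simplicial tree on which `G`
acts by simplicial isometries without inversion, with finite quotient graph and infinite cyclic
vertex and edge stabilizers. A group is a generalized Baumslag–Solitar group when it has such a
tree. -/
structure IsCyclicSplitting (G : Type u) [Group G] {T : Type v} [MetricSpace T] [MulAction G T]
    (V : Set T) : Prop where
  tree : IsMetricTree V
  isometric : ∀ (g : G) (x y : T), dist (g • x) (g • y) = dist x y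
  vertices : ∀ (g : G), ∀ v ∈ V, g • v ∈ V
  no_inversion : ∀ (g : G) (v w : T), IsEdge V v w → ¬ (g • v = w ∧ g • w = v)
  finite_vertices : ∃ F : Set T, F.Finite ∧ ∀ v ∈ V, ∃ g : G, ∃ u ∈ F, g • u = v
  finite_edges : ∃ F : Set (T × T), F.Finite ∧
    ∀ v w, IsEdge V v w → ∃ g : G, ∃ p ∈ F, g • p.1 = v ∧ g • p.2 = w
  vertex_cyclic : ∀ v ∈ V, IsCyclic (MulAction.stabilizer G v)
  vertex_infinite : ∀ v ∈ V, Infinite (MulAction.stabilizer G v)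
  edge_cyclic : ∀ v w, IsEdge V v w →
    IsCyclic (MulAction.stabilizer G v ⊓ MulAction.stabilizer G w : Subgroup G)
  edge_infinite : ∀ v w, IsEdge V v w →
    Infinite (MulAction.stabilizer G v ⊓ MulAction.stabilizer G w : Subgroup G)

/-- `T` is a tree of the cyclic deformation space of `G`: a minimal tree as above. -/
structure InDeformationSpace (G : Type u) [Group G] {T : Type v} [MetricSpace T] [MulAction G T]
    (V : Set T) : Prop extends IsCyclicSplitting G V where
  minimal : ∀ Y : Set T, IsSubtree V Y → (∀ (g : G), ∀ x ∈ Y, g • x ∈ Y) → Y = Set.univ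

/-- `H` is a (proper, non-elliptic) cyclic factor of `G`. A connected subgraph `Γ_H` of a graph of
cyclic groups `Γ` corresponds to a subtree `Y` of the Bass–Serre tree `S` of `Γ` which is a
component of the preimage of `Γ_H`, that is, whose translates are equal to it or disjoint from
it, and the conjugates of `π₁(Γ_H)` are the stabilizers of such `Y`. -/
def IsCyclicFactor {G : Type u} [Group G] (H : Subgroup G) : Prop :=
  ∃ (S : Type u) (_ : MetricSpace S) (_ : MulAction G S) (V Y : Set S),
    IsCyclicSplitting G V ∧ IsSubtree V Y ∧
    (∀ g : G, (g • ·) '' Y = Y ∨ Disjoint ((g • ·) '' Y) Y) ∧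
    (∀ g : G, g ∈ H ↔ (g • ·) '' Y = Y) ∧
    H ≠ ⊤ ∧ ¬ ∃ x : S, ∀ h ∈ H, h • x = x

/-- `φ` is fully irreducible: no power `φ^k`, `k ≥ 1`, preserves the conjugacy class of a cyclic
factor. This depends only on the class of `φ` modulo inner automorphisms. -/
def IsFullyIrreducible {G : Type u} [Group G] (φ : MulAut G) : Prop :=
  ∀ k : ℕ, 1 ≤ k → ∀ H : Subgroup G, IsCyclicFactor H →
    ¬ ∃ g : G, H.map (φ ^ k).toMonoidHom = H.map (MulAut.conj g).toMonoidHom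

/-- `f : T → T` is a train track representative of `φ` which is linear on edges with stretching
factor `lam` on every edge: it is `φ`-equivariant, maps vertices to vertices and each edge
homothetically onto a nondegenerate non-backtracking path, there are at least two gates at
each vertex, and the iterated images of edges cross only legal turns for the gate structure
induced by `f`. -/
structure IsTrainTrack {G : Type u} [Group G] {T : Type v} [MetricSpace T] [MulAction G T]
    (V : Set T) (φ : MulAut G) (f : T → T) (lam : ℝ) : Prop where
  equivariant : ∀ (g : G) (x : T), f (g • x) = φ g • f x
  vertices : ∀ v ∈ V, f v ∈ V
  linear : ∀ v w, IsEdge V v w → ∀ x ∈ seg v w, ∀ y ∈ seg v w,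
    dist (f x) (f y) = lam * dist x y
  nondegenerate : ∀ v w, IsEdge V v w → f v ≠ f w
  two_gates : ∀ v ∈ V, ∃ a b, IsEdge V v a ∧ IsEdge V v b ∧ ¬ InducedGate V f v a b
  legal : ∀ v w, IsEdge V v w →
    ∀ γ : ℝ → T, γ 0 = v → γ (dist v w) = w → IsGeodesicOn γ (Set.Icc 0 (dist v w)) →
    ∀ (k : ℕ) (u a b : T), IsEdge V u a → IsEdge V u b →
      CrossesTurn (f^[k] ∘ γ) (Set.Icc 0 (dist v w)) u a b → ¬ InducedGate V f u a b

end GBS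

/-! A shortest edge is sent to a path between distinct vertices, so `lam ≥ 1`, hence `lam > 1`. In a
tree, geodesics overlapping in a nondegenerate segment concatenate to a geodesic. A map homothetic
on edges is therefore homothetic along any geodesic whose turns it does not fold
(`dist_eq_of_tight`). By induction `f^n` stretches each edge by `lam ^ n`, and then also each legal
path.

Bounded backtracking amounts to a bound on the fibres of `f`. Vertex stabilizers are commensurable,
so `φ⁻¹` of a vertex stabilizer has bounded orbits. Sending `g • u` to `φ⁻¹ g • u`, for `u` among
finitely many orbit representatives, thus gives a coarsely well-defined map on vertices. It is
Lipschitz there and a coarse left inverse of `f`, so points with equal images are close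
(`exists_fiber_bound`).

Iteration turns `B` into `R = B (1 + ... + lam ^ (n-1))`, with `2R = C_f (lam ^ n - 1)`. The ends of
`f^n(β)` are within `R` of the tightened path, so only end pieces of length `R` can be lost. For `L
= len β > 2 C_f` the surviving length is at least `lam ^ n L - C_f (lam ^ n - 1) ≥ lam ^ n L / 2`.
-/

namespace GBS

/-! ### Segments in a real tree -/

section Tree

variable {T : Type v} [MetricSpace T] {V : Set T}

theorem left_mem_seg (x y : T) : x ∈ seg x y := by simp [seg]

theorem right_mem_seg (x y : T) : y ∈ seg x y := by simp [seg]

theorem mem_seg_symm {x y p : T} (h : p ∈ seg x y) : p ∈ seg y x := by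
  simp only [seg, Set.mem_ofPred_eq] at *
  rw [dist_comm y p, dist_comm p x, dist_comm y x]
  linarith

theorem eq_of_mem_seg_self {x p : T} (h : p ∈ seg x x) : p = x := by
  simp only [seg, Set.mem_ofPred_eq, dist_self] at h
  rw [dist_comm x p] at h
  exact dist_le_zero.1 (by linarith [dist_nonneg (x := p) (y := x)])

theorem mem_seg_of_mem_left {x y p q : T} (hp : p ∈ seg x y) (hq : q ∈ seg x p) :
    q ∈ seg x y := by
  simp only [seg, Set.mem_ofPred_eq] at *
  linarith [dist_triangle q p y, dist_triangle x q y]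

theorem mem_seg_of_mem_right {x y p q : T} (hp : p ∈ seg x y) (hq : q ∈ seg p y) :
    q ∈ seg x y :=
  mem_seg_symm (mem_seg_of_mem_left (mem_seg_symm hp) (mem_seg_symm hq))

/-- If `q` precedes `p` on `[x, y]`, then `p` lies on `[q, y]`. -/
theorem mem_seg_drop_left {x y p q : T} (hp : p ∈ seg x y) (hq : q ∈ seg x p) :
    p ∈ seg q y := by
  simp only [seg, Set.mem_ofPred_eq] at *
  linarith [dist_triangle q p y, dist_triangle x q y]

/-- A point of `[x, y]` at distance at least `dist x y` from `x` is `y`. -/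
theorem eq_right_of_dist_le {x y p : T} (hp : p ∈ seg x y) (h : dist x y ≤ dist x p) :
    p = y := by
  simp only [seg, Set.mem_ofPred_eq] at hp
  exact dist_le_zero.1 (by linarith)

theorem IsEdge.symm {v w : T} (h : IsEdge V v w) : IsEdge V w v :=
  ⟨h.2.1, h.1, h.2.2.1.symm, fun z hz hzV => (h.2.2.2 z (mem_seg_symm hz) hzV).symm⟩

namespace IsMetricTree

theorem eq_of_mem_seg (hV : IsMetricTree V) {x y p q : T} (hp : p ∈ seg x y) (hq : q ∈ seg x y)
    (h : dist x p = dist x q) : p = q := by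
  simp only [seg, Set.mem_ofPred_eq] at *
  have h4 := hV.hyperbolic p q x y
  rw [dist_comm p x, dist_comm q x] at h4
  apply dist_le_zero.1
  rcases le_max_iff.1 h4 with h' | h' <;> linarith

/-- Triangles are tripods: cancelling one half of `dist x y` in the four-point inequality makes a
triangle inequality through `p` an equality. -/
theorem mem_seg_or (hV : IsMetricTree V) {x y p : T} (hp : p ∈ seg x y) (z : T) :
    p ∈ seg x z ∨ p ∈ seg z y := by
  simp only [seg, Set.mem_ofPred_eq] at *
  have h4 := hV.hyperbolic p z x y
  rw [dist_comm p x] at h4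
  rcases le_max_iff.1 h4 with h' | h'
  · right
    linarith [dist_comm z p, dist_triangle z p y]
  · left
    linarith [dist_comm z x, dist_triangle x p z]

/-- Two overlapping segments concatenate to a segment. -/
theorem mem_seg_concat (hV : IsMetricTree V) {x y z w : T} (hy : y ∈ seg x z) (hz : z ∈ seg y w)
    (hne : y ≠ z) :
    z ∈ seg x w := by
  simp only [seg, Set.mem_ofPred_eq] at *
  have h4 := hV.hyperbolic x z y w
  have := dist_pos.2 hne
  rw [dist_comm z y] at h4
  -- The first alternative would give `dist y z ≤ 0`: the nondegenerate overlap excludes turning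
  -- back.
  rcases le_max_iff.1 h4 with h' | h'
  · linarith
  · linarith [dist_triangle x z w]

theorem seg_subset_seg (hV : IsMetricTree V) {x y p q : T} (hp : p ∈ seg x y) (hq : q ∈ seg x y) :
    seg p q ⊆ seg x y := by
  intro r hr
  rcases hV.mem_seg_or hp q with h | h
  · exact mem_seg_of_mem_left hq (mem_seg_of_mem_right h hr)
  · exact mem_seg_of_mem_right hq (mem_seg_of_mem_left h (mem_seg_symm hr))

theorem exists_mem_seg_dist_eq (hV : IsMetricTree V) (x y : T) {c : ℝ} (h0 : 0 ≤ c)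
    (h1 : c ≤ dist x y) :
    ∃ p ∈ seg x y, dist x p = c := by
  obtain ⟨γ, rfl, h2, h⟩ := hV.geodesic x y
  set D := dist (γ 0) y
  have e1 := h 0 ⟨le_rfl, h0.trans h1⟩ c ⟨h0, h1⟩
  have e2 := h c ⟨h0, h1⟩ D ⟨h0.trans h1, le_rfl⟩
  rw [h2, abs_of_nonpos (by linarith)] at e2
  rw [abs_of_nonpos (by linarith)] at e1
  refine ⟨γ c, ?_, by linarith⟩
  change dist (γ 0) (γ c) + dist (γ c) y = D
  linarith

/-- Any three points of a real tree have a median. -/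
theorem exists_median (hV : IsMetricTree V) (x y z : T) :
    ∃ m, m ∈ seg x y ∧ m ∈ seg x z ∧ m ∈ seg y z := by
  -- The distance from `x` to the median is the Gromov product of `y` and `z` at `x`.
  obtain ⟨m, hm, hd⟩ := hV.exists_mem_seg_dist_eq x y
    (c := (dist x y + dist x z - dist y z) / 2)
    (by linarith [dist_triangle y x z, dist_comm x y])
    (by linarith [dist_triangle x y z])
  have h4 := hV.hyperbolic m z x y
  refine ⟨m, hm, ?_⟩
  simp only [seg, Set.mem_ofPred_eq] at *
  rw [dist_comm m x, dist_comm z x, dist_comm z y] at h4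
  have : dist m z ≤ (dist x z + dist y z - dist x y) / 2 := by
    rcases le_max_iff.1 h4 with h' | h' <;> linarith
  constructor
  · linarith [dist_triangle x m z]
  · linarith [dist_triangle y m z, dist_comm y m]

/-- A homothety of a convex set maps segments onto segments. -/
theorem seg_subset_image (hV : IsMetricTree V) {g : T → T} {c : ℝ} (hc : 0 < c) {x y : T}
    (h : ∀ p ∈ seg x y, ∀ q ∈ seg x y, dist (g p) (g q) = c * dist p q) :
    seg (g x) (g y) ⊆ g '' seg x y := by
  intro q hq
  have hxy := h x (left_mem_seg x y) y (right_mem_seg x y)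
  have hq' : dist (g x) q + dist q (g y) = dist (g x) (g y) := hq
  obtain ⟨p, hp, hd⟩ := hV.exists_mem_seg_dist_eq x y (c := dist (g x) q / c) (by positivity)
    (by rw [div_le_iff₀ hc]; linarith [dist_nonneg (x := q) (y := g y)])
  have h1 := h x (left_mem_seg x y) p hp
  have h2 := h p hp y (right_mem_seg x y)
  have h3 : dist x p + dist p y = dist x y := hp
  refine ⟨p, hp, hV.eq_of_mem_seg (x := g x) (y := g y) ?_ hq ?_⟩
  · change dist (g x) (g p) + dist (g p) (g y) = dist (g x) (g y)
    rw [h1, h2, hxy, ← h3]; ring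
  · rw [h1, hd]; field_simp

/-! ### Vertices and edges -/

/-- A segment without interior vertices can be prolonged to one that starts at a vertex. -/
theorem exists_vertex_prolongation (hV : IsMetricTree V) {x y : T}
    (h : ∀ z ∈ seg x y, z ∈ V → z = x ∨ z = y) :
    ∃ v ∈ V, x ∈ seg v y ∧ ∀ z ∈ seg v y, z ∈ V → z = v ∨ z = y := by
  by_cases hx : x ∈ V
  · exact ⟨x, hx, left_mem_seg x y, h⟩
  suffices ∃ v w, IsEdge V v w ∧ x ∈ seg v w ∧ x ∈ seg v y by
    obtain ⟨v, w, he, hxe, hxy⟩ := this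
    refine ⟨v, he.1, hxy, fun z hz hzV => ?_⟩
    rcases hV.mem_seg_or hz x with hz' | hz'
    · rcases he.2.2.2 z (mem_seg_of_mem_left hxe hz') hzV with rfl | rfl
      · exact Or.inl rfl
      · have e1 : dist v x + dist x z = dist v z := hxe
        have e2 : dist v z + dist z x = dist v x := hz'
        have : z = x := dist_le_zero.1 (by linarith [dist_comm x z])
        exact absurd (this ▸ hzV) hx
    · rcases h z hz' hzV with rfl | rfl
      · exact absurd hzV hx
      · exact Or.inr rfl
  obtain ⟨v, w, he, hxe⟩ := (hV.cover x).resolve_left hx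
  rcases hV.mem_seg_or hxe y with hxy | hxy
  · exact ⟨v, w, he, hxe, hxy⟩
  · exact ⟨w, v, he.symm, mem_seg_symm hxe, mem_seg_symm hxy⟩

/-- A nondegenerate segment without interior vertices is contained in an edge. -/
theorem exists_edge_of_no_vertex (hV : IsMetricTree V) {x y : T} (hne : x ≠ y)
    (h : ∀ z ∈ seg x y, z ∈ V → z = x ∨ z = y) :
    ∃ v w, IsEdge V v w ∧ x ∈ seg v w ∧ y ∈ seg v w := by
  obtain ⟨v, hv, hx, h1⟩ := hV.exists_vertex_prolongation h
  obtain ⟨w, hw, hy, h2⟩ := hV.exists_vertex_prolongation (x := y) (y := v)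
    (fun z hz hzV => (h1 z (mem_seg_symm hz) hzV).symm)
  refine ⟨v, w, ⟨hv, hw, ?_, fun z hz hzV => (h2 z (mem_seg_symm hz) hzV).symm⟩,
    mem_seg_of_mem_left (mem_seg_symm hy) hx, mem_seg_symm hy⟩
  rintro rfl
  obtain rfl := eq_of_mem_seg_self hy
  exact hne (eq_of_mem_seg_self hx)

/-- Induction over the subdivision of a segment by the vertices that it contains. -/
theorem seg_induction (hV : IsMetricTree V) {P : T → T → Prop} (hrefl : ∀ x, P x x)
    (hedge : ∀ v w, IsEdge V v w → ∀ x ∈ seg v w, ∀ y ∈ seg v w, x ≠ y → P x y)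
    (hjoin : ∀ x y, ∀ m ∈ seg x y, m ∈ V → m ≠ x → m ≠ y → P x m → P m y → P x y)
    (x y : T) : P x y := by
  -- Endpoints are not counted, so splitting at `m` lowers the count of both halves.
  suffices ∀ (n : ℕ) (x y : T), (V ∩ (seg x y \ {x, y})).ncard = n → P x y from this _ x y rfl
  intro n
  induction n using Nat.strong_induction_on with
  | _ n ih =>
  intro x y hn
  have hfin : (V ∩ (seg x y \ {x, y})).Finite :=
    (hV.finite_vertices x y).subset fun z hz => ⟨hz.1, hz.2.1⟩
  rcases eq_or_ne x y with rfl | hne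
  · exact hrefl x
  by_cases h : ∀ z ∈ seg x y, z ∈ V → z = x ∨ z = y
  · obtain ⟨v, w, he, hx, hy⟩ := hV.exists_edge_of_no_vertex hne h
    exact hedge v w he x hx y hy hne
  push Not at h
  obtain ⟨m, hm, hmV, hmx, hmy⟩ := h
  have hm' : dist x m + dist m y = dist x y := hm
  have hpx := dist_pos.2 hmx
  have hpy := dist_pos.2 hmy
  refine hjoin x y m hm hmV hmx hmy (ih _ ?_ x m rfl) (ih _ ?_ m y rfl)
  · rw [← hn]
    refine Set.ncard_lt_ncard ((Set.ssubset_iff_of_subset ?_).2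
      ⟨m, ⟨hmV, hm, by simp [hmx, hmy]⟩, fun hc => hc.2.2 (by simp)⟩) hfin
    rintro z ⟨hzV, hz, hzn⟩
    simp only [Set.mem_insert_iff, Set.mem_singleton_iff, not_or] at hzn
    refine ⟨hzV, mem_seg_of_mem_left hm hz, ?_⟩
    simp only [Set.mem_insert_iff, Set.mem_singleton_iff, not_or]
    refine ⟨hzn.1, ?_⟩
    rintro rfl
    have hz' : dist x z + dist z m = dist x m := hz
    linarith [dist_comm z m]
  · rw [← hn]
    refine Set.ncard_lt_ncard ((Set.ssubset_iff_of_subset ?_).2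
      ⟨m, ⟨hmV, hm, by simp [hmx, hmy]⟩, fun hc => hc.2.2 (by simp)⟩) hfin
    rintro z ⟨hzV, hz, hzn⟩
    simp only [Set.mem_insert_iff, Set.mem_singleton_iff, not_or] at hzn
    refine ⟨hzV, mem_seg_of_mem_right hm hz, ?_⟩
    simp only [Set.mem_insert_iff, Set.mem_singleton_iff, not_or]
    refine ⟨?_, hzn.2⟩
    rintro rfl
    have hz' : dist m z + dist z y = dist m y := hz
    linarith [dist_comm z m]

/-- Induction over edge paths between vertices. -/
theorem vertex_induction (hV : IsMetricTree V) {P : T → T → Prop} (hrefl : ∀ x ∈ V, P x x)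
    (hedge : ∀ v w, IsEdge V v w → P v w)
    (hjoin : ∀ x ∈ V, ∀ y ∈ V, ∀ m ∈ V, m ∈ seg x y → m ≠ x → m ≠ y →
      P x m → P m y → P x y)
    {x y : T} (hx : x ∈ V) (hy : y ∈ V) : P x y := by
  refine hV.seg_induction (P := fun x y => x ∈ V → y ∈ V → P x y) (fun x hx _ => hrefl x hx)
    ?_ ?_ x y hx hy
  · intro v w he x hx y hy hne hxV hyV
    rcases he.2.2.2 x hx hxV with rfl | rfl <;> rcases he.2.2.2 y hy hyV with rfl | rfl
    · exact absurd rfl hne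
    · exact hedge _ _ he
    · exact hedge _ _ he.symm
    · exact absurd rfl hne
  · intro x y m hm hmV hmx hmy h1 h2 hxV hyV
    exact hjoin x hxV y hyV m hmV hm hmx hmy (h1 hxV hmV) (h2 hmV hyV)

/-- A segment that ends at a vertex `u` arrives there along an edge. -/
theorem exists_edge_at_vertex (hV : IsMetricTree V) {x u : T} (hu : u ∈ V) (hne : x ≠ u) :
    ∃ a, IsEdge V u a ∧ ∃ x' ∈ seg x u, x' ≠ u ∧ x' ∈ seg u a := by
  refine hV.seg_induction (P := fun x u => u ∈ V → x ≠ u →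
    ∃ a, IsEdge V u a ∧ ∃ x' ∈ seg x u, x' ≠ u ∧ x' ∈ seg u a)
    (fun x _ h => absurd rfl h) ?_ ?_ x u hu hne
  · intro v w he x hx y hy hne hyV _
    rcases he.2.2.2 y hy hyV with rfl | rfl
    · exact ⟨w, he, x, left_mem_seg _ _, hne, hx⟩
    · exact ⟨v, he.symm, x, left_mem_seg _ _, hne, mem_seg_symm hx⟩
  · intro x y m hm _ _ hmy _ h2 hyV _
    obtain ⟨a, ha, x', hx', hne', hx'a⟩ := h2 hyV hmy
    exact ⟨a, ha, x', mem_seg_of_mem_right hm hx', hne', hx'a⟩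

end IsMetricTree

/-! ### Maps that are homothetic on edges -/

section Homothety

variable {g : T → T} {c : ℝ}

/-- The map `g` multiplies distances by `c` on each edge. -/
def IsEdgeHomothety (V : Set T) (g : T → T) (c : ℝ) : Prop :=
  ∀ v w, IsEdge V v w → ∀ x ∈ seg v w, ∀ y ∈ seg v w, dist (g x) (g y) = c * dist x y

theorem IsEdgeHomothety.dist_le (hV : IsMetricTree V) (hg : IsEdgeHomothety V g c) (x y : T) :
    dist (g x) (g y) ≤ c * dist x y := by
  refine hV.seg_induction (P := fun x y => dist (g x) (g y) ≤ c * dist x y) (by simp)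
    (fun v w he x hx y hy _ => (hg v w he x hx y hy).le) ?_ x y
  intro x y m hm _ _ _ h1 h2
  have hm' : dist x m + dist m y = dist x y := hm
  calc dist (g x) (g y) ≤ dist (g x) (g m) + dist (g m) (g y) := dist_triangle _ _ _
    _ ≤ c * dist x m + c * dist m y := add_le_add h1 h2
    _ = c * dist x y := by rw [← hm']; ring

/-- A path between two points of a tree covers the segment joining them; here the preimage is found
piece by piece. -/
theorem IsEdgeHomothety.seg_subset_image (hV : IsMetricTree V) (hc : 0 < c)
    (hg : IsEdgeHomothety V g c) (x y : T) : seg (g x) (g y) ⊆ g '' seg x y := by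
  refine hV.seg_induction (P := fun x y => seg (g x) (g y) ⊆ g '' seg x y) ?_ ?_ ?_ x y
  · intro x q hq
    exact ⟨x, left_mem_seg x x, (eq_of_mem_seg_self hq).symm⟩
  · intro v w he x hx y hy _
    exact hV.seg_subset_image hc fun p hp q hq =>
      hg v w he p (hV.seg_subset_seg hx hy hp) q (hV.seg_subset_seg hx hy hq)
  · intro x y m hm _ _ _ h1 h2 q hq
    rcases hV.mem_seg_or hq (g m) with h | h
    · obtain ⟨p, hp, rfl⟩ := h1 h
      exact ⟨p, mem_seg_of_mem_left hm hp, rfl⟩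
    · obtain ⟨p, hp, rfl⟩ := h2 h
      exact ⟨p, mem_seg_of_mem_right hm hp, rfl⟩

/-- The images of the edges `[u, a]` and `[u, b]` form a non-backtracking path. -/
def IsTightTurn (g : T → T) (u a b : T) : Prop :=
  ∀ x ∈ seg u a, ∀ y ∈ seg u b, g u ∈ seg (g x) (g y)

/-- If a turn is folded, then the images of its edges share a nondegenerate segment. -/
theorem exists_seg_subset_of_not_isTightTurn (hV : IsMetricTree V) (hc : 0 < c)
    (hg : IsEdgeHomothety V g c) {u a b : T} (h : ¬ IsTightTurn g u a b) :
    ∃ z, z ≠ g u ∧ seg (g u) z ⊆ g '' seg u a ∩ g '' seg u b := by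
  unfold IsTightTurn at h
  push Not at h
  obtain ⟨x, hx, y, hy, hxy⟩ := h
  -- The images of `[u, x]` and `[u, y]` share the segment up to this median, which differs from `g
  -- u` because the turn is folded.
  obtain ⟨m, h1, h2, h3⟩ := hV.exists_median (g u) (g x) (g y)
  have key : ∀ {a x : T}, x ∈ seg u a → m ∈ seg (g u) (g x) →
      seg (g u) m ⊆ g '' seg u a := by
    intro a x hx hm q hq
    obtain ⟨p, hp, rfl⟩ := hg.seg_subset_image hV hc u x (mem_seg_of_mem_left hm hq)
    exact ⟨p, mem_seg_of_mem_left hx hp, rfl⟩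
  exact ⟨m, fun h => hxy (h ▸ h3), fun q hq => ⟨key hx h1 hq, key hy h2 hq⟩⟩

/-- A geodesic all of whose turns are tight for `g` is mapped homothetically by `g`. -/
theorem IsEdgeHomothety.dist_eq_of_tight (hV : IsMetricTree V) (hc : 0 < c)
    (hg : IsEdgeHomothety V g c) {γ : ℝ → T} {J : Set ℝ} (hJ : J.OrdConnected)
    (hγ : IsGeodesicOn γ J)
    (hturn : ∀ u a b, IsEdge V u a → IsEdge V u b → CrossesTurn γ J u a b →
      IsTightTurn g u a b) :
    ∀ s ∈ J, ∀ t ∈ J, dist (g (γ s)) (g (γ t)) = c * |s - t| := by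
  have mem : ∀ s ∈ J, ∀ t ∈ J, s ≤ t → ∀ m ∈ seg (γ s) (γ t),
      ∃ r ∈ Set.Icc s t, γ r = m := by
    intro s hs t ht hst m hm
    have hm' : dist (γ s) m + dist m (γ t) = dist (γ s) (γ t) := hm
    have hd := hγ s hs t ht
    rw [abs_of_nonpos (by linarith)] at hd
    have hr : s + dist (γ s) m ∈ Set.Icc s t :=
      ⟨by linarith [dist_nonneg (x := γ s) (y := m)],
        by linarith [dist_nonneg (x := m) (y := γ t)]⟩
    have hrJ := hJ.out hs ht hr
    refine ⟨_, hr, hV.eq_of_mem_seg (x := γ s) (y := γ t) ?_ hm ?_⟩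
    · change dist _ _ + dist _ _ = dist _ _
      rw [hγ s hs _ hrJ, hγ _ hrJ t ht, hd, abs_of_nonpos (by linarith [hr.1]),
        abs_of_nonpos (by linarith [hr.2])]
      ring
    · rw [hγ s hs _ hrJ]; simp
  have seg_of : ∀ s ∈ J, ∀ t ∈ J, ∀ r ∈ J, s ≤ r → r ≤ t → γ r ∈ seg (γ s) (γ t) := by
    intro s hs t ht r hr h1 h2
    change dist _ _ + dist _ _ = dist _ _
    rw [hγ s hs r hr, hγ r hr t ht, hγ s hs t ht, abs_of_nonpos (by linarith),
        abs_of_nonpos (by linarith), abs_of_nonpos (by linarith)]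
    ring
  have key : ∀ x y : T, ∀ s ∈ J, ∀ t ∈ J, s ≤ t → γ s = x → γ t = y →
      ∀ s' ∈ Set.Icc s t, ∀ t' ∈ Set.Icc s t, s' ≤ t' →
        dist (g (γ s')) (g (γ t')) = c * (t' - s') := by
    refine hV.seg_induction ?_ ?_ ?_
    · intro x s hs t ht hst h1 h2 s' hs' t' ht' _
      have hd := hγ s hs t ht
      rw [h1, h2, dist_self] at hd
      have hst' := sub_eq_zero.1 (abs_eq_zero.1 hd.symm)
      have e1 : s' = s := le_antisymm (hst' ▸ hs'.2) hs'.1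
      have e2 : t' = s := le_antisymm (hst' ▸ ht'.2) ht'.1
      rw [e1, e2]; simp
    · intro v w he x hx y hy _ s hs t ht hst h1 h2 s' hs' t' ht' hst'
      subst h1 h2
      have m1 := seg_of s hs t ht s' (hJ.out hs ht hs') hs'.1 hs'.2
      have m2 := seg_of s hs t ht t' (hJ.out hs ht ht') ht'.1 ht'.2
      rw [hg v w he _ (hV.seg_subset_seg hx hy m1) _ (hV.seg_subset_seg hx hy m2),
        hγ s' (hJ.out hs ht hs') t' (hJ.out hs ht ht'), abs_of_nonpos (by linarith)]
      ring
    · intro x y m hm hmV hmx hmy ih1 ih2 s hs t ht hst h1 h2 s' hs' t' ht' hst'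
      subst h1 h2
      obtain ⟨r, hr, rfl⟩ := mem s hs t ht hst m hm
      have hrJ := hJ.out hs ht hr
      have I1 := ih1 s hs r hrJ hr.1 rfl rfl
      have I2 := ih2 r hrJ t ht hr.2 rfl rfl
      have hsr : s < r := lt_of_le_of_ne hr.1 fun h => hmx (by rw [h])
      have hrt : r < t := lt_of_le_of_ne hr.2 fun h => hmy (by rw [h])
      rcases le_or_gt t' r with h | h
      · exact I1 s' ⟨hs'.1, hst'.trans h⟩ t' ⟨ht'.1, h⟩ hst'
      rcases le_or_gt r s' with h0 | h0
      · exact I2 s' ⟨h0, hs'.2⟩ t' ⟨h0.trans hst', ht'.2⟩ hst'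
      have hs'J := hJ.out hs ht hs'
      have ht'J := hJ.out hs ht ht'
      have ne1 : γ s' ≠ γ r := by
        intro he
        have := hγ s' hs'J r hrJ
        rw [he, dist_self] at this
        linarith [sub_eq_zero.1 (abs_eq_zero.1 this.symm)]
      have ne2 : γ t' ≠ γ r := by
        intro he
        have := hγ t' ht'J r hrJ
        rw [he, dist_self] at this
        linarith [sub_eq_zero.1 (abs_eq_zero.1 this.symm)]
      -- Near the vertex the path runs inside two edges; times `p < r < q` are chosen there to
      -- exhibit the crossed turn.
      obtain ⟨a, ha, x1, hx1, hx1r, hx1a⟩ := hV.exists_edge_at_vertex hmV ne1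
      obtain ⟨b, hb, y1, hy1, hy1r, hy1b⟩ := hV.exists_edge_at_vertex hmV ne2
      obtain ⟨p, hp, rfl⟩ := mem s' hs'J r hrJ h0.le x1 hx1
      obtain ⟨q, hq, rfl⟩ := mem r hrJ t' ht'J h.le y1 (mem_seg_symm hy1)
      have hpJ := hJ.out hs'J hrJ hp
      have hqJ := hJ.out hrJ ht'J hq
      have hpr : p < r := lt_of_le_of_ne hp.2 fun h => hx1r (by rw [h])
      have hrq : r < q := lt_of_le_of_ne hq.1 fun h => hy1r (by rw [h])
      have inj : ∀ z ∈ J, z ≠ r → γ z ≠ γ r := by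
        intro z hz hne he
        have := hγ z hz r hrJ
        rw [he, dist_self] at this
        exact hne (sub_eq_zero.1 (abs_eq_zero.1 this.symm))
      have tight := hturn (γ r) a b ha hb
        ⟨p, r, q, hpr, hrq, hJ.out hpJ hqJ, rfl,
          fun z hz => by
            have hzJ := hJ.out hpJ hrJ ⟨hz.1, hz.2.le⟩
            exact ⟨mem_seg_of_mem_left hx1a
              (mem_seg_symm (seg_of p hpJ r hrJ z hzJ hz.1 hz.2.le)), inj z hzJ hz.2.ne⟩,
          fun z hz => by
            have hzJ := hJ.out hrJ hqJ ⟨hz.1.le, hz.2⟩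
            exact ⟨mem_seg_of_mem_left hy1b
              (seg_of r hrJ q hqJ z hzJ hz.1.le hz.2), inj z hzJ hz.1.ne'⟩⟩
        (γ p) hx1a (γ q) hy1b
      have d1 := I1 s' ⟨hs'.1, h0.le⟩ p ⟨hs'.1.trans hp.1, hp.2⟩ hp.1
      have d2 := I1 p ⟨hs'.1.trans hp.1, hp.2⟩ r ⟨hsr.le, le_rfl⟩ hp.2
      have d3 := I1 s' ⟨hs'.1, h0.le⟩ r ⟨hsr.le, le_rfl⟩ h0.le
      have d4 := I2 r ⟨le_rfl, hrt.le⟩ q ⟨hq.1, hq.2.trans ht'.2⟩ hq.1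
      have d5 := I2 q ⟨hq.1, hq.2.trans ht'.2⟩ t' ⟨h.le, ht'.2⟩ hq.2
      have d6 := I2 r ⟨le_rfl, hrt.le⟩ t' ⟨h.le, ht'.2⟩ h.le
      have np : g (γ p) ≠ g (γ r) := dist_pos.1 (d2 ▸ mul_pos hc (sub_pos.2 hpr))
      have nq : g (γ r) ≠ g (γ q) := dist_pos.1 (d4 ▸ mul_pos hc (sub_pos.2 hrq))
      -- Two concatenations: the first overlaps in the image of `[p, r]`, the second in that of `[r,
      -- q]`.
      have A : g (γ r) ∈ seg (g (γ s')) (g (γ q)) := by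
        refine hV.mem_seg_concat ?_ tight np
        change dist _ _ + dist _ _ = dist _ _
        rw [d1, d2, d3]; ring
      have hB : g (γ q) ∈ seg (g (γ r)) (g (γ t')) := by
        change dist _ _ + dist _ _ = dist _ _
        rw [d4, d5, d6]; ring
      have hC := hV.mem_seg_concat A hB nq
      have e1 : dist _ _ + dist _ _ = dist _ _ := A
      have e2 : dist _ _ + dist _ _ = dist _ _ := hC
      rw [← e2, ← e1, d3, d4, d5]; ring
  intro s hs t ht
  rcases le_total s t with h | h
  · rw [key _ _ s hs t ht h rfl rfl s ⟨le_rfl, h⟩ t ⟨h, le_rfl⟩ h, abs_of_nonpos (by linarith)]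
    ring
  · rw [dist_comm, key _ _ t ht s hs h rfl rfl t ⟨le_rfl, h⟩ s ⟨h, le_rfl⟩ h,
      abs_of_nonneg (by linarith)]

end Homothety

end Tree

/-! ### Cocompactness and commensurability of stabilizers -/

section Action

variable {G : Type u} [Group G] {T : Type v} [MetricSpace T] [MulAction G T] {V : Set T}

namespace IsCyclicSplitting

theorem finite_edge_lengths (hT : IsCyclicSplitting G V) :
    {l : ℝ | ∃ v w, IsEdge V v w ∧ dist v w = l}.Finite := by
  obtain ⟨F, hF, h⟩ := hT.finite_edges
  refine (hF.image fun p => dist p.1 p.2).subset ?_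
  rintro _ ⟨v, w, he, rfl⟩
  obtain ⟨g, p, hp, rfl, rfl⟩ := h v w he
  exact ⟨p, hp, (hT.isometric g _ _).symm⟩

/-- There is a shortest edge, and distinct vertices are at least its length apart. -/
theorem exists_shortest_edge (hT : IsCyclicSplitting G V) {v₀ w₀ : T} (he₀ : IsEdge V v₀ w₀) :
    ∃ v w, IsEdge V v w ∧ ∀ x ∈ V, ∀ y ∈ V, x ≠ y → dist v w ≤ dist x y := by
  obtain ⟨l, ⟨v, w, he, rfl⟩, hmin⟩ := Set.exists_min_image _ id hT.finite_edge_lengths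
    ⟨_, v₀, w₀, he₀, rfl⟩
  refine ⟨v, w, he, fun x hx y hy => hT.tree.vertex_induction
    (P := fun x y => x ≠ y → dist v w ≤ dist x y) (fun x _ h => absurd rfl h)
    (fun v' w' he' _ => hmin _ ⟨v', w', he', rfl⟩) ?_ hx hy⟩
  intro x _ y _ m _ hm hmx _ h1 _ _
  have hm' : dist x m + dist m y = dist x y := hm
  linarith [h1 hmx.symm, dist_nonneg (x := m) (y := y)]

theorem exists_vertex_near (hT : IsCyclicSplitting G V) :
    ∃ D : ℝ, 0 ≤ D ∧ ∀ x : T, ∃ v ∈ V, dist x v ≤ D := by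
  obtain ⟨D, hD⟩ := hT.finite_edge_lengths.bddAbove
  refine ⟨max D 0, le_max_right _ _, fun x => ?_⟩
  rcases hT.tree.cover x with hx | ⟨v, w, he, hx⟩
  · exact ⟨x, hx, by simp⟩
  · have hx' : dist v x + dist x w = dist v w := hx
    have h1 : dist v w ≤ D := hD ⟨v, w, he, rfl⟩
    refine ⟨v, he.1, le_max_of_le_left ?_⟩
    linarith [dist_comm x v, dist_nonneg (x := x) (y := w)]

theorem exists_generator (hT : IsCyclicSplitting G V) {v : T} (hv : v ∈ V) :
    ∃ t : G, t • v = v ∧ (∀ g : G, g • v = v → ∃ k : ℤ, g = t ^ k) ∧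
      ∀ k : ℤ, t ^ k = 1 → k = 0 := by
  obtain ⟨⟨t, ht⟩, hgen⟩ := (hT.vertex_cyclic v hv).exists_generator
  have hinf := hT.vertex_infinite v hv
  refine ⟨t, ht, fun g hg => ?_, fun k hk => ?_⟩
  · obtain ⟨k, hk⟩ := Subgroup.mem_zpowers_iff.1 (hgen ⟨g, hg⟩)
    exact ⟨k, by simpa using (congrArg Subtype.val hk).symm⟩
  · have h0 : ¬ IsOfFinOrder (⟨t, ht⟩ : MulAction.stabilizer G v) := by
      intro hfin
      have h1 := finite_zpowers.2 hfin
      rw [show ((Subgroup.zpowers (⟨t, ht⟩ : MulAction.stabilizer G v) :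
        Set (MulAction.stabilizer G v))) = Set.univ from
          Set.eq_univ_of_forall fun x => hgen x] at h1
      exact Set.infinite_univ h1
    refine injective_zpow_iff_not_isOfFinOrder.2 h0 (Subtype.ext ?_)
    simpa using hk

/-- Any two vertex stabilizers are commensurable. -/
theorem exists_pow_smul_eq (hT : IsCyclicSplitting G V) {v w : T} (hv : v ∈ V) (hw : w ∈ V) :
    ∀ g : G, g • v = v → ∃ n : ℕ, n ≠ 0 ∧ g ^ n • w = w := by
  refine hT.tree.vertex_induction
    (P := fun v w => ∀ g : G, g • v = v → ∃ n : ℕ, n ≠ 0 ∧ g ^ n • w = w)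
    (fun x _ g hg => ⟨1, one_ne_zero, by simpa using hg⟩) ?_ ?_ hv hw
  · intro v w he g hg
    obtain ⟨t, ht, hgen, -⟩ := hT.exists_generator he.1
    have := hT.edge_infinite v w he
    obtain ⟨⟨s, hs⟩, hs1⟩ := exists_ne
      (1 : (MulAction.stabilizer G v ⊓ MulAction.stabilizer G w : Subgroup G))
    obtain ⟨m, rfl⟩ := hgen s hs.1
    obtain ⟨k, rfl⟩ := hgen g hg
    -- `t ^ m` is a nontrivial element of the edge group, and `(t ^ k) ^ |m|` is a power of it.
    have hm : m ≠ 0 := by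
      rintro rfl
      exact hs1 (Subtype.ext (by simp))
    refine ⟨m.natAbs, by simpa using hm, ?_⟩
    have hmem : (t ^ m) ^ (k * m.sign) ∈ MulAction.stabilizer G w :=
      Subgroup.zpow_mem _ hs.2 _
    have e : (t ^ k) ^ m.natAbs = (t ^ m) ^ (k * m.sign) := by
      rw [← zpow_natCast, ← zpow_mul, ← zpow_mul, ← Int.sign_mul_self]
      congr 1; ring
    rw [e]
    exact hmem
  · intro x _ y _ m _ _ _ _ h1 h2 g hg
    obtain ⟨n, hn, hgn⟩ := h1 g hg
    obtain ⟨k, hk, hgk⟩ := h2 _ hgn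
    exact ⟨n * k, mul_ne_zero hn hk, by rwa [pow_mul]⟩

end IsCyclicSplitting

namespace IsTrainTrack

variable {φ : MulAut G} {f : T → T} {lam : ℝ}

theorem isEdgeHomothety (hf : IsTrainTrack V φ f lam) : IsEdgeHomothety V f lam := hf.linear

theorem one_le (hT : IsCyclicSplitting G V) (hf : IsTrainTrack V φ f lam) : 1 ≤ lam := by
  obtain ⟨v₀, hv₀⟩ := hT.tree.nonempty
  obtain ⟨a, _, ha, _⟩ := hf.two_gates v₀ hv₀
  obtain ⟨v, w, he, hmin⟩ := hT.exists_shortest_edge ha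
  have h1 := hmin _ (hf.vertices v he.1) _ (hf.vertices w he.2.1) (hf.nondegenerate v w he)
  rw [hf.linear v w he v (left_mem_seg v w) w (right_mem_seg v w)] at h1
  have := dist_pos.2 he.2.2.1
  nlinarith

/-! ### Bounded backtracking -/

/-- The preimage under `φ` of a vertex stabilizer has bounded orbits. -/
theorem exists_orbit_bound (hT : IsCyclicSplitting G V) (hf : IsTrainTrack V φ f lam)
    {u : T} (hu : u ∈ V) :
    ∃ K : ℝ, ∀ g : G, g • u = u → dist u (φ⁻¹ g • u) ≤ K := by
  obtain ⟨t, ht, hgen, htf⟩ := hT.exists_generator hu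
  -- By commensurability some `φ (t ^ n)` with `n ≠ 0` fixes `u`, so it equals some `t ^ k`. Then
  -- `(φ⁻¹ t) ^ k = t ^ n` fixes `u`, and the orbit of `u` under `φ⁻¹ t` is finite.
  have h1 : φ t • f u = f u := by rw [← hf.equivariant, ht]
  obtain ⟨n, hn, h2⟩ := hT.exists_pow_smul_eq (hf.vertices u hu) hu _ h1
  obtain ⟨k, hk⟩ := hgen _ h2
  have hk0 : k ≠ 0 := by
    rintro rfl
    have h3 : φ (t ^ n) = 1 := by rw [map_pow, hk, zpow_zero]
    have h4 : t ^ n = 1 := (map_eq_one_iff φ φ.injective).1 h3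
    exact hn (by exact_mod_cast htf n (by exact_mod_cast h4))
  set s := φ⁻¹ t with hs
  have hsk : s ^ k = t ^ n := by
    rw [hs, ← map_zpow, ← hk, ← map_pow]
    simp
  have hfix : s ^ k • u = u := by
    rw [hsk]
    exact (MulAction.stabilizer G u).pow_mem ht n
  obtain ⟨K, hK⟩ := ((Set.finite_Ico (0 : ℤ) |k|).image fun j => dist u (s ^ j • u)).bddAbove
  refine ⟨K, fun g hg => ?_⟩
  obtain ⟨j, rfl⟩ := hgen g hg
  have e : φ⁻¹ (t ^ j) • u = s ^ (j % k) • u := by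
    rw [map_zpow, ← hs]
    conv_lhs => rw [← Int.emod_add_mul_ediv j k]
    rw [zpow_add, zpow_mul, mul_smul]
    congr 1
    exact (MulAction.stabilizer G u).zpow_mem hfix _
  rw [e]
  exact hK ⟨j % k, ⟨Int.emod_nonneg _ hk0, Int.emod_lt_abs _ hk0⟩, rfl⟩

/-- A train track map has a coarsely `φ⁻¹`-equivariant coarse left inverse on the vertices. -/
theorem exists_coarse_inverse (hT : IsCyclicSplitting G V) (hf : IsTrainTrack V φ f lam) :
    ∃ (h : T → T) (K : ℝ), (∀ v ∈ V, ∀ g : G, dist (h (g • v)) (φ⁻¹ g • h v) ≤ K) ∧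
      ∀ v ∈ V, dist (h (f v)) v ≤ K := by
  classical
  obtain ⟨F, hF, hcov⟩ := hT.finite_vertices
  have hrep : ∀ v : T, ∃ p : G × T, v ∈ V → p.2 ∈ F ∧ p.2 ∈ V ∧ p.1 • p.2 = v := by
    intro v
    by_cases hv : v ∈ V
    · obtain ⟨g, u, hu, rfl⟩ := hcov v hv
      refine ⟨(g, u), fun _ => ⟨hu, ?_, rfl⟩⟩
      simpa using hT.vertices g⁻¹ _ hv
    · exact ⟨(1, v), fun h => absurd h hv⟩
  choose p hp using hrep
  -- Two representations of the same vertex give nearby values.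
  have hpair : ∃ K : ℝ, ∀ u ∈ F, ∀ u' ∈ F, u ∈ V → ∀ g : G, g • u' = u → u' ∈ V →
      dist (φ⁻¹ g • u') u ≤ K := by
    have : ∀ q : T × T, ∃ K : ℝ, q.1 ∈ V → q.2 ∈ V → ∀ g : G, g • q.2 = q.1 →
        dist (φ⁻¹ g • q.2) q.1 ≤ K := by
      rintro ⟨u, u'⟩
      by_cases hu' : u' ∈ V
      -- All `g` carrying `u'` to `u` lie in one coset of the stabilizer of `u'`, so one reference
      -- element `g₀` suffices.
      · by_cases hex : ∃ g₀ : G, g₀ • u' = u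
        · obtain ⟨g₀, hg₀⟩ := hex
          obtain ⟨K, hK⟩ := hf.exists_orbit_bound hT hu'
          refine ⟨K + dist (φ⁻¹ g₀ • u') u, fun _ _ g hg => ?_⟩
          have h1 : (g₀⁻¹ * g) • u' = u' := by
            change g • u' = u at hg
            rw [mul_smul, hg, ← hg₀, inv_smul_smul]
          have h2 := hK _ h1
          rw [← hT.isometric (φ⁻¹ g₀), smul_smul, ← map_mul, mul_inv_cancel_left,
            dist_comm] at h2
          exact (dist_triangle _ (φ⁻¹ g₀ • u') _).trans (by gcongr)
        · exact ⟨0, fun _ _ g hg => absurd ⟨g, hg⟩ hex⟩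
      · exact ⟨0, fun _ h => absurd h hu'⟩
    choose K hK using this
    obtain ⟨M, hM⟩ := ((hF.prod hF).image K).bddAbove
    exact ⟨M, fun u hu u' hu' hV g hg hV' =>
      (hK (u, u') hV hV' g hg).trans (hM ⟨(u, u'), ⟨hu, hu'⟩, rfl⟩)⟩
  obtain ⟨K, hK⟩ := hpair
  set h : T → T := fun v => φ⁻¹ (p v).1 • (p v).2 with hh
  have hequiv : ∀ v ∈ V, ∀ g : G, dist (h (g • v)) (φ⁻¹ g • h v) ≤ K := by
    intro v hv g
    obtain ⟨h1, h2, h3⟩ := hp v hv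
    obtain ⟨h4, h5, h6⟩ := hp (g • v) (hT.vertices g v hv)
    have h7 : ((p (g • v)).1⁻¹ * g * (p v).1) • (p v).2 = (p (g • v)).2 := by
      rw [mul_smul, h3, mul_smul, inv_smul_eq_iff, h6]
    have h8 := hK _ h4 _ h1 h5 _ h7 h2
    rw [← hT.isometric (φ⁻¹ (p (g • v)).1), smul_smul, ← map_mul, mul_assoc,
      mul_inv_cancel_left, map_mul, mul_smul, dist_comm] at h8
    exact h8
  -- The bound on representatives spreads to all vertices, as `h ∘ f` is coarsely `G`-equivariant.
  obtain ⟨M, hM⟩ := (hF.image fun u => dist (h (f u)) u).bddAbove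
  refine ⟨h, max K (K + M), fun v hv g => (hequiv v hv g).trans (le_max_left _ _),
    fun v hv => le_max_of_le_right ?_⟩
  obtain ⟨g, u, hu, rfl⟩ := hcov v hv
  have huV : u ∈ V := by simpa using hT.vertices g⁻¹ _ hv
  have h1 := hequiv (f u) (hf.vertices u huV) (φ g)
  have h2 : dist (h (f u)) u ≤ M := hM ⟨u, hu, rfl⟩
  rw [← hf.equivariant, MulAut.inv_apply_self] at h1
  rw [← hT.isometric g] at h2
  exact (dist_triangle _ _ _).trans (add_le_add h1 h2)

/-- Points with the same image under a train track map are at bounded distance. -/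
theorem exists_fiber_bound (hT : IsCyclicSplitting G V) (hf : IsTrainTrack V φ f lam) :
    ∃ K : ℝ, ∀ x y, f x = f y → dist x y ≤ K := by
  obtain ⟨h, K, hequiv, hinv⟩ := hf.exists_coarse_inverse hT
  have hlam := hf.one_le hT
  obtain ⟨v₀, hv₀⟩ := hT.tree.nonempty
  obtain ⟨a, _, ha, _⟩ := hf.two_gates v₀ hv₀
  obtain ⟨v₁, w₁, he, hmin⟩ := hT.exists_shortest_edge ha
  set ε := dist v₁ w₁
  have hε : 0 < ε := dist_pos.2 he.2.2.1
  have hedge : ∃ M : ℝ, 0 ≤ M ∧ ∀ v w, IsEdge V v w → dist (h v) (h w) ≤ M := by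
    obtain ⟨F, hF, hcov⟩ := hT.finite_edges
    obtain ⟨M, hM⟩ := (hF.image fun p => dist (h p.1) (h p.2)).bddAbove
    refine ⟨max (K + M + K) 0, le_max_right _ _, fun v w he => le_max_of_le_left ?_⟩
    obtain ⟨g, p, hp, rfl, rfl⟩ := hcov v w he
    have hV1 : p.1 ∈ V := by simpa using hT.vertices g⁻¹ _ he.1
    have hV2 : p.2 ∈ V := by simpa using hT.vertices g⁻¹ _ he.2.1
    have h1 : dist (h p.1) (h p.2) ≤ M := hM ⟨p, hp, rfl⟩
    rw [← hT.isometric (φ⁻¹ g)] at h1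
    have h2 := hequiv _ hV2 g
    rw [dist_comm] at h2
    exact (dist_triangle4 _ _ _ _).trans (add_le_add (add_le_add (hequiv _ hV1 g) h1) h2)
  obtain ⟨M, hM0, hM⟩ := hedge
  have hlip : ∀ v ∈ V, ∀ w ∈ V, dist (h v) (h w) ≤ M / ε * dist v w := by
    intro v hv w hw
    refine hT.tree.vertex_induction (P := fun v w => dist (h v) (h w) ≤ M / ε * dist v w)
      (by simp) (fun v w he => ?_) ?_ hv hw
    · refine (hM v w he).trans ?_
      rw [div_mul_eq_mul_div, le_div_iff₀ hε]
      exact mul_le_mul_of_nonneg_left (hmin v he.1 w he.2.1 he.2.2.1) hM0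
    · intro x _ y _ m _ hm _ _ h1 h2
      have hm' : dist x m + dist m y = dist x y := hm
      rw [← hm', mul_add]
      exact (dist_triangle _ _ _).trans (add_le_add h1 h2)
  obtain ⟨D, hD0, hD⟩ := hT.exists_vertex_near
  -- `D` moves each point to a vertex, `K` is the error of `h ∘ f`, and the middle term is the
  -- Lipschitz bound for `h` on the vertex images.
  refine ⟨D + (K + M / ε * (lam * D + lam * D) + K) + D, fun x y hxy => ?_⟩
  obtain ⟨v, hv, hxv⟩ := hD x
  obtain ⟨w, hw, hyw⟩ := hD y
  have hl : 0 ≤ lam := by linarith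
  have h1 : dist (f v) (f w) ≤ lam * D + lam * D := by
    refine (dist_triangle _ (f x) _).trans (add_le_add ?_ ?_)
    · refine (hf.isEdgeHomothety.dist_le hT.tree v x).trans ?_
      rw [dist_comm]; gcongr
    · rw [hxy]
      refine (hf.isEdgeHomothety.dist_le hT.tree y w).trans ?_
      gcongr
  have h2 := hlip _ (hf.vertices v hv) _ (hf.vertices w hw)
  have h3 : dist (h (f v)) (h (f w)) ≤ M / ε * (lam * D + lam * D) := h2.trans (by gcongr)
  have h4 : dist v w ≤ K + M / ε * (lam * D + lam * D) + K := by
    refine (dist_triangle4 v (h (f v)) (h (f w)) w).trans ?_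
    have := hinv v hv
    rw [dist_comm] at this
    exact add_le_add (add_le_add this h3) (hinv w hw)
  refine (dist_triangle4 x v w y).trans ?_
  rw [dist_comm w y]
  exact add_le_add (add_le_add hxv h4) hyw

/-- The projection `q` of `f p` to `[f x, f y]` lies on the segments from `f p` to both ends. It
thus has a preimage on each side of `p`; these are `K`-close with `p` between them. -/
theorem exists_isBBT (hT : IsCyclicSplitting G V) (hf : IsTrainTrack V φ f lam) :
    ∃ B : ℝ, IsBBT f B := by
  obtain ⟨K, hK⟩ := hf.exists_fiber_bound hT
  have hlam : 0 < lam := zero_lt_one.trans_le (hf.one_le hT)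
  refine ⟨lam * K, fun x y p hp => ?_⟩
  obtain ⟨q, hq, hqx, hqy⟩ := hT.tree.exists_median (f x) (f y) (f p)
  obtain ⟨x', hx', ex⟩ := hf.isEdgeHomothety.seg_subset_image hT.tree hlam x p hqx
  obtain ⟨y', hy', ey⟩ := hf.isEdgeHomothety.seg_subset_image hT.tree hlam y p hqy
  refine ⟨q, hq, ?_⟩
  have h1 : p ∈ seg x' y := mem_seg_drop_left hp hx'
  have h2 : p ∈ seg y' x' := mem_seg_drop_left (mem_seg_symm h1) hy'
  have h3 : dist y' p + dist p x' = dist y' x' := h2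
  have h4 := hK y' x' (ey.trans ex.symm)
  rw [← ex]
  refine (hf.isEdgeHomothety.dist_le hT.tree p x').trans ?_
  gcongr
  linarith [dist_nonneg (x := y') (y := p)]

end IsTrainTrack

end Action

/-! ### Length of homothetic images of intervals -/

section Length

variable {T : Type v} [MetricSpace T]

theorem len_mono {S S' : Set T} (h : S ⊆ S') : len S ≤ len S' := by
  let _ : MeasurableSpace T := borel T
  have _ : BorelSpace T := ⟨rfl⟩
  exact MeasureTheory.measure_mono h

/-- Both `η` and its inverse are Lipschitz, with constants `c` and `c⁻¹`, and one-dimensional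
Hausdorff measure on the line is Lebesgue measure. -/
theorem len_image_of_homothety {η : ℝ → T} {S : Set ℝ} {c : ℝ} (hc : 0 < c)
    (h : ∀ s ∈ S, ∀ t ∈ S, dist (η s) (η t) = c * |s - t|) :
    len (η '' S) = ENNReal.ofReal c * MeasureTheory.volume S := by
  let _ : MeasurableSpace T := borel T
  have _ : BorelSpace T := ⟨rfl⟩
  change MeasureTheory.Measure.hausdorffMeasure 1 (η '' S) = _
  rw [← MeasureTheory.hausdorffMeasure_real]
  apply le_antisymm
  · have hl : LipschitzOnWith c.toNNReal η S := LipschitzOnWith.of_dist_le_mul fun s hs t ht => by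
      rw [h s hs t ht, Real.coe_toNNReal c hc.le, Real.dist_eq]
    simpa [ENNReal.ofReal] using hl.hausdorffMeasure_image_le zero_le_one
  · have hinj : Set.InjOn η S := by
      intro s hs t ht hst
      have h1 := h s hs t ht
      rw [hst, dist_self] at h1
      rcases mul_eq_zero.1 h1.symm with h2 | h2
      · exact absurd h2 hc.ne'
      · exact sub_eq_zero.1 (abs_eq_zero.1 h2)
    have hl : LipschitzOnWith c⁻¹.toNNReal (Function.invFunOn η S) (η '' S) := by
      refine LipschitzOnWith.of_dist_le_mul ?_
      rintro _ ⟨s, hs, rfl⟩ _ ⟨t, ht, rfl⟩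
      rw [hinj.leftInvOn_invFunOn hs, hinj.leftInvOn_invFunOn ht, h s hs t ht,
        Real.coe_toNNReal _ (inv_pos.2 hc).le, Real.dist_eq, inv_mul_cancel_left₀ hc.ne']
    have h1 := hl.hausdorffMeasure_image_le zero_le_one
    rw [hinj.leftInvOn_invFunOn.image_image, ENNReal.rpow_one] at h1
    change _ ≤ ENNReal.ofReal c⁻¹ * _ at h1
    rw [ENNReal.ofReal_inv_of_pos hc] at h1
    calc ENNReal.ofReal c * MeasureTheory.Measure.hausdorffMeasure 1 S
        ≤ ENNReal.ofReal c * ((ENNReal.ofReal c)⁻¹ *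
          MeasureTheory.Measure.hausdorffMeasure 1 (η '' S)) := by gcongr
      _ = _ := by
        rw [← mul_assoc, ENNReal.mul_inv_cancel (by simpa using hc) ENNReal.ofReal_ne_top,
          one_mul]

theorem IsMetricTree.len_seg_pos {V : Set T} (hV : IsMetricTree V) {x y : T} (hne : x ≠ y) :
    0 < len (seg x y) := by
  obtain ⟨γ, h0, h1, h⟩ := hV.geodesic x y
  have hlen := len_image_of_homothety (η := γ) one_pos (S := Set.Icc 0 (dist x y))
    fun s hs t ht => by rw [h s hs t ht, one_mul]
  have hpos : 0 < len (γ '' Set.Icc 0 (dist x y)) := by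
    rw [hlen]
    simpa using hne
  refine hpos.trans_le (len_mono ?_)
  rintro _ ⟨t, ht, rfl⟩
  have hD := dist_nonneg (x := x) (y := y)
  have e1 := h 0 ⟨le_rfl, hD⟩ t ht
  have e2 := h t ht (dist x y) ⟨hD, le_rfl⟩
  rw [h0, abs_of_nonpos (by linarith [ht.1])] at e1
  rw [h1, abs_of_nonpos (by linarith [ht.2])] at e2
  change dist x (γ t) + dist (γ t) y = dist x y
  linarith

/-- This reduces paths that are infinite or lack endpoints to compact subpaths. -/
theorem exists_lt_sub_of_lt_volume {J : Set ℝ} {c : ℝ}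
    (h : ENNReal.ofReal c < MeasureTheory.volume J) : ∃ s ∈ J, ∃ t ∈ J, c < t - s := by
  by_contra! hcon
  refine absurd ((Real.volume_le_diam J).trans (Metric.ediam_le fun s hs t ht => ?_)) h.not_ge
  rw [edist_dist, Real.dist_eq]
  exact ENNReal.ofReal_le_ofReal (abs_le.2 ⟨by linarith [hcon s hs t ht], hcon t ht s hs⟩)

end Length

/-! ### Iterates of train track maps -/

section Iterate

variable {G : Type u} [Group G] {T : Type v} [MetricSpace T] [MulAction G T] {V : Set T}
  {φ : MulAut G} {f : T → T} {lam : ℝ}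

/-- The edge images at a folded turn overlap in positive length, a generating pair of the gate
relation. -/
theorem isTightTurn_of_not_inducedGate (hV : IsMetricTree V) (hc : 0 < lam)
    (hg : IsEdgeHomothety V f lam) {u a b : T} (ha : IsEdge V u a) (hb : IsEdge V u b)
    (h : ¬ InducedGate V f u a b) : IsTightTurn f u a b := by
  by_contra hcon
  obtain ⟨z, hz, hsub⟩ := exists_seg_subset_of_not_isTightTurn hV hc hg hcon
  exact h (.rel _ _ ⟨ha, hb, ((hV.len_seg_pos hz.symm).trans_le (len_mono hsub)).ne'⟩)

theorem isTightTurn_of_not_trainTrackGate (hV : IsMetricTree V) {c : ℝ} (hc : 0 < c) {n : ℕ}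
    (hg : IsEdgeHomothety V f^[n] c) {u a b : T}
    (h : ¬ TrainTrackGate f u a b) : IsTightTurn f^[n] u a b := by
  by_contra hcon
  obtain ⟨z, hz, hsub⟩ := exists_seg_subset_of_not_isTightTurn hV hc hg hcon
  exact h ⟨n, fun hs => hz (hs (hsub (right_mem_seg _ z)) (hsub (left_mem_seg _ z)))⟩

namespace IsTrainTrack

/-- The iterates of a train track map are homothetic on edges. -/
theorem isEdgeHomothety_iterate (hV : IsMetricTree V) (hlam : 0 < lam)
    (hf : IsTrainTrack V φ f lam) (n : ℕ) : IsEdgeHomothety V f^[n] (lam ^ n) := by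
  induction n with
  | zero => intro v w _ x _ y _; simp
  | succ n ih =>
    intro v w he x hx y hy
    obtain ⟨γ, h0, h1, hγ⟩ := hV.geodesic v w
    have hln : 0 < lam ^ n := pow_pos hlam n
    set D := dist v w
    have hD : 0 ≤ D := dist_nonneg
    have hseg : ∀ t ∈ Set.Icc 0 D, γ t ∈ seg v w := by
      intro t ht
      have e1 := hγ 0 ⟨le_rfl, hD⟩ t ht
      have e2 := hγ t ht D ⟨hD, le_rfl⟩
      rw [h0, abs_of_nonpos (by linarith [ht.1])] at e1
      rw [h1, abs_of_nonpos (by linarith [ht.2])] at e2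
      change dist v (γ t) + dist (γ t) w = D
      linarith
    have hpar : ∀ z ∈ seg v w, ∃ t ∈ Set.Icc 0 D, γ t = z := by
      intro z hz
      have hz' : dist v z + dist z w = D := hz
      have ht : dist v z ∈ Set.Icc 0 D :=
        ⟨dist_nonneg, by linarith [dist_nonneg (x := z) (y := w)]⟩
      refine ⟨_, ht, hV.eq_of_mem_seg (hseg _ ht) hz ?_⟩
      have e1 := hγ 0 ⟨le_rfl, hD⟩ _ ht
      rw [h0, abs_of_nonpos (by linarith [ht.1])] at e1
      linarith
    -- The arc length parametrization of the image of the edge under `f^[n]`.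
    set η : ℝ → T := fun t => f^[n] (γ (t / lam ^ n)) with hη
    set J : Set ℝ := Set.Icc 0 (lam ^ n * D) with hJ
    have hdiv : ∀ {t}, t ∈ J → t / lam ^ n ∈ Set.Icc 0 D := fun {t} ht =>
      ⟨div_nonneg ht.1 hln.le, by rw [div_le_iff₀ hln, mul_comm]; exact ht.2⟩
    have hmulJ : ∀ {t}, t ∈ Set.Icc 0 D → lam ^ n * t ∈ J := fun {t} ht =>
      ⟨mul_nonneg hln.le ht.1, mul_le_mul_of_nonneg_left ht.2 hln.le⟩
    have hcancel : ∀ t, lam ^ n * t / lam ^ n = t := fun t => mul_div_cancel_left₀ t hln.ne'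
    have hηg : IsGeodesicOn η J := by
      intro s hs t ht
      rw [hη]
      simp only
      rw [ih v w he _ (hseg _ (hdiv hs)) _ (hseg _ (hdiv ht)), hγ _ (hdiv hs) _ (hdiv ht),
        ← sub_div, abs_div, abs_of_pos hln, mul_div_cancel₀ _ hln.ne']
    -- One more application of `f` to the already geodesic path `η`: the train track condition says
    -- that its turns are not folded.
    have hmain := hf.isEdgeHomothety.dist_eq_of_tight hV hlam (J := J) Set.ordConnected_Icc hηg
      (fun u a b ha hb hcross => by
        refine isTightTurn_of_not_inducedGate hV hlam hf.isEdgeHomothety ha hb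
          (hf.legal v w he γ h0 h1 hγ n u a b ha hb ?_)
        obtain ⟨s, t, r, hst, htr, hsub, hu, hl, hr⟩ := hcross
        have hs := hdiv (hsub ⟨le_rfl, (hst.trans htr).le⟩)
        have hr' := hdiv (hsub ⟨(hst.trans htr).le, le_rfl⟩)
        refine ⟨s / lam ^ n, t / lam ^ n, r / lam ^ n, div_lt_div_of_pos_right hst hln,
          div_lt_div_of_pos_right htr hln, fun z hz => ⟨hs.1.trans hz.1, hz.2.trans hr'.2⟩, hu,
          fun z hz => ?_, fun z hz => ?_⟩
        · have := hl (lam ^ n * z) ⟨(div_le_iff₀' hln).1 hz.1, (lt_div_iff₀' hln).1 hz.2⟩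
          simpa only [hη, hcancel, Function.comp_apply] using this
        · have := hr (lam ^ n * z) ⟨(div_lt_iff₀' hln).1 hz.1, (le_div_iff₀' hln).1 hz.2⟩
          simpa only [hη, hcancel, Function.comp_apply] using this)
    obtain ⟨s, hs, rfl⟩ := hpar x hx
    obtain ⟨t, ht, rfl⟩ := hpar y hy
    have := hmain _ (hmulJ hs) _ (hmulJ ht)
    simp only [hη, hcancel] at this
    rw [Function.iterate_succ_apply', Function.iterate_succ_apply', this, hγ s hs t ht,
      ← mul_sub, abs_mul, abs_of_pos hln, pow_succ]
    ring

/-- Legal geodesics are mapped homothetically by the iterates of a train track map. -/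
theorem dist_iterate_of_isLegal (hV : IsMetricTree V) (hlam : 0 < lam)
    (hf : IsTrainTrack V φ f lam) {α : ℝ → T} {J : Set ℝ} (hJ : J.OrdConnected)
    (hα : IsGeodesicOn α J) (hleg : IsLegal V f α J) (n : ℕ) :
    ∀ s ∈ J, ∀ t ∈ J, dist (f^[n] (α s)) (f^[n] (α t)) = lam ^ n * |s - t| := by
  have hE := hf.isEdgeHomothety_iterate hV hlam n
  have hln := pow_pos hlam n
  -- `TrainTrackGate` ranges over all iterates, so legal turns are tight for `f^[n]` directly.
  exact hE.dist_eq_of_tight hV hln hJ hα fun u a b ha hb hcross =>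
    isTightTurn_of_not_trainTrackGate hV hln hE (hleg u a b ha hb hcross)

/-- In `f^[n+1] = f^[n] ∘ f`, the error `B` of the inner `f` is stretched by at most `lam ^ n` and
added to the error of `f^[n]`. -/
theorem isBBT_iterate (hV : IsMetricTree V) (hlam : 0 < lam)
    (hf : IsTrainTrack V φ f lam) {B : ℝ} (hB : IsBBT f B) (n : ℕ) :
    IsBBT f^[n] (B * ∑ i ∈ Finset.range n, lam ^ i) := by
  induction n with
  | zero => intro x y p hp; exact ⟨p, hp, by simp⟩
  | succ n ih =>
    intro x y p hp
    obtain ⟨q, hq, hpq⟩ := hB x y p hp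
    obtain ⟨r, hr, hqr⟩ := ih (f x) (f y) q hq
    refine ⟨r, hr, ?_⟩
    rw [Function.iterate_succ_apply, Finset.sum_range_succ, mul_add]
    have h1 : dist (f^[n] (f p)) (f^[n] q) ≤ B * lam ^ n := by
      refine ((hf.isEdgeHomothety_iterate hV hlam n).dist_le hV _ _).trans ?_
      rw [mul_comm]
      gcongr
    linarith [dist_triangle (f^[n] (f p)) (f^[n] q) r]

end IsTrainTrack

/-- If the endpoints of `[x, y]` are within `R` of `[a, b]`, then the points of `[x, y]` at
distance at least `R` from the endpoints lie on `[a, b]`. -/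
theorem IsMetricTree.mem_seg_of_near (hV : IsMetricTree V) {a b x y x' y' p : T} {R : ℝ}
    (hx' : x' ∈ seg a b) (hy' : y' ∈ seg a b) (hx : dist x x' ≤ R) (hy : dist y y' ≤ R)
    (hp : p ∈ seg x y) (hpx : R ≤ dist x p) (hpy : R ≤ dist y p) : p ∈ seg a b := by
  -- If `p` lies on `[x, x']`, of length at most `R`, then it is `x'` itself; likewise at `y`.
  rcases hV.mem_seg_or hp x' with h | h
  · rwa [eq_right_of_dist_le h (hx.trans hpx)]
  rcases hV.mem_seg_or h y' with h | h
  · exact hV.seg_subset_seg hx' hy' h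
  · rwa [eq_right_of_dist_le (mem_seg_symm h) (hy.trans hpy)]

/-- The part of a homothetic subpath that survives tightening. -/
theorem image_subset_tighten (hV : IsMetricTree V) {g : T → T} {c R : ℝ} (hc : 0 < c)
    (hg : IsBBT g R) {α : ℝ → T} {I : Set ℝ} (hI : I.OrdConnected)
    (hα : IsGeodesicOn α I) {s t : ℝ} (hs : s ∈ I) (ht : t ∈ I) (hst : s ≤ t)
    (hd : ∀ x ∈ Set.Icc s t, ∀ y ∈ Set.Icc s t, dist (g (α x)) (g (α y)) = c * |x - y|)
    (hR : 0 ≤ R) :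
    (g ∘ α) '' Set.Icc (s + R / c) (t - R / c) ⊆ tighten (g ∘ α) I := by
  rintro _ ⟨r, hr, rfl⟩
  have hRc : 0 ≤ R / c := div_nonneg hR hc.le
  have hrs : r ∈ Set.Icc s t := ⟨by linarith [hr.1], by linarith [hr.2]⟩
  have hsst : s ∈ Set.Icc s t := ⟨le_rfl, hst⟩
  have htst : t ∈ Set.Icc s t := ⟨hst, le_rfl⟩
  -- The bound `R` is uniform in `a ≤ s` and `b ≥ t`, so finite and infinite paths are treated
  -- alike.
  refine ⟨s, hs, t, ht, hst, fun a ha b hb has htb => ?_⟩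
  have hmem : ∀ x ∈ Set.Icc s t, α x ∈ seg (α a) (α b) := by
    intro x hx
    have hxI := hI.out hs ht hx
    change dist _ _ + dist _ _ = dist _ _
    rw [hα a ha x hxI, hα x hxI b hb, hα a ha b hb, abs_of_nonpos (by linarith [hx.1]),
      abs_of_nonpos (by linarith [hx.2]), abs_of_nonpos (by linarith)]
    ring
  obtain ⟨x', hx', hxx⟩ := hg _ _ _ (hmem s hsst)
  obtain ⟨y', hy', hyy⟩ := hg _ _ _ (hmem t htst)
  refine hV.mem_seg_of_near hx' hy' hxx hyy ?_ ?_ ?_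
  · change dist _ _ + dist _ _ = dist _ _
    simp only [Function.comp_apply]
    rw [hd s hsst r hrs, hd r hrs t htst, hd s hsst t htst, abs_of_nonpos (by linarith [hrs.1]),
      abs_of_nonpos (by linarith [hrs.2]), abs_of_nonpos (by linarith)]
    ring
  · simp only [Function.comp_apply]
    rw [hd s hsst r hrs, abs_of_nonpos (by linarith [hrs.1])]
    exact (div_le_iff₀' hc).1 (by linarith [hr.1])
  · simp only [Function.comp_apply]
    rw [hd t htst r hrs, abs_of_nonneg (by linarith [hrs.2])]
    exact (div_le_iff₀' hc).1 (by linarith [hr.2])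

end Iterate

end GBS

/-! ### The length estimate -/

theorem mainTheorem2 {G : Type*} [Group G] (hG : ¬ Group.IsSolvable G)
    {T : Type*} [MetricSpace T] [MulAction G T] {V : Set T}
    (hT : GBS.InDeformationSpace G V)
    (φ : MulAut G) (hφ : GBS.IsFullyIrreducible φ)
    (f : T → T) (lam : ℝ) (hf : GBS.IsTrainTrack V φ f lam) (hlam : lam ≠ 1) :
    (∃ B : ℝ, GBS.IsBBT f B) ∧
    ∀ B : ℝ, GBS.IsBBT f B →
      ∀ (α : ℝ → T) (I J : Set ℝ), I.OrdConnected → GBS.IsGeodesicOn α I →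
        J ⊆ I → J.OrdConnected → GBS.IsLegal V f α J →
        ENNReal.ofReal (2 * GBS.criticalConstant B lam) < GBS.len (α '' J) →
        ∀ n : ℕ,
          ENNReal.ofReal (1 / 2 * lam ^ n) * GBS.len (α '' J) ≤
            GBS.len (f^[n] '' (α '' J) ∩ GBS.tighten (f^[n] ∘ α) I) := by
  have hS := hT.toIsCyclicSplitting
  have hV := hS.tree
  have h1lam : 1 < lam := lt_of_le_of_ne (hf.one_le hS) hlam.symm
  have h0lam : 0 < lam := zero_lt_one.trans h1lam
  refine ⟨hf.exists_isBBT hS, fun B hB α I J hI hα hJI hJ hleg hlong n => ?_⟩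
  have hB0 : 0 ≤ B := by
    obtain ⟨v, -⟩ := hV.nonempty
    obtain ⟨q, -, hq⟩ := hB v v v (GBS.left_mem_seg v v)
    exact dist_nonneg.trans hq
  set C := GBS.criticalConstant B lam with hC
  have hC0 : 0 ≤ C := div_nonneg (by positivity) (by linarith)
  have hαJ : GBS.IsGeodesicOn α J := fun s hs t ht => hα s (hJI hs) t (hJI ht)
  rw [GBS.len_image_of_homothety one_pos (fun s hs t ht => by rw [hαJ s hs t ht, one_mul]),
    ENNReal.ofReal_one, one_mul] at hlong ⊢
  have hln : 0 < lam ^ n := pow_pos h0lam n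
  set R := B * ∑ i ∈ Finset.range n, lam ^ i with hR
  have hR0 : 0 ≤ R := mul_nonneg hB0 (Finset.sum_nonneg fun i _ => (pow_pos h0lam i).le)
  have hRC : 2 * R = C * (lam ^ n - 1) := by
    rw [hR, hC, GBS.criticalConstant, geom_sum_eq hlam]
    ring
  have hbbt := hf.isBBT_iterate hV h0lam hB n
  have hdist := hf.dist_iterate_of_isLegal hV h0lam hJ hαJ hleg n
  -- `J` may be unbounded or lack endpoints, so its length is approximated from below by `c`.
  have key : ∀ c : ℝ, 2 * C ≤ c → ENNReal.ofReal c < MeasureTheory.volume J →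
      ENNReal.ofReal (1 / 2 * lam ^ n) * ENNReal.ofReal c ≤
        GBS.len (f^[n] '' (α '' J) ∩ GBS.tighten (f^[n] ∘ α) I) := by
    intro c hc hcJ
    obtain ⟨s, hs, t, ht, hst⟩ := GBS.exists_lt_sub_of_lt_volume hcJ
    have hsub := hJ.out hs ht
    have hsubset : (f^[n] ∘ α) '' Set.Icc (s + R / lam ^ n) (t - R / lam ^ n) ⊆
        f^[n] '' (α '' J) ∩ GBS.tighten (f^[n] ∘ α) I := by
      refine Set.subset_inter ?_ (GBS.image_subset_tighten hV hln hbbt hI hα (hJI hs) (hJI ht)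
        (by linarith) (fun x hx y hy => hdist x (hsub hx) y (hsub hy)) hR0)
      rw [Set.image_comp]
      refine Set.image_mono (Set.image_mono fun r hr => hsub ?_)
      have : 0 ≤ R / lam ^ n := by positivity
      exact ⟨by linarith [hr.1], by linarith [hr.2]⟩
    refine le_trans ?_ (GBS.len_mono hsubset)
    rw [GBS.len_image_of_homothety hln fun x hx y hy => ?_, Real.volume_Icc,
      ← ENNReal.ofReal_mul (by positivity), ← ENNReal.ofReal_mul hln.le]
    · refine ENNReal.ofReal_le_ofReal ?_
      have e : lam ^ n * (t - R / lam ^ n - (s + R / lam ^ n)) = lam ^ n * (t - s) - 2 * R := by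
        field_simp
        ring
      rw [e, hRC]
      nlinarith
    · have : 0 ≤ R / lam ^ n := by positivity
      exact hdist x (hsub ⟨by linarith [hx.1], by linarith [hx.2]⟩) y
        (hsub ⟨by linarith [hy.1], by linarith [hy.2]⟩)
  have hpos : ENNReal.ofReal (1 / 2 * lam ^ n) ≠ 0 := by
    simpa using hln
  rw [mul_comm, ← ENNReal.le_div_iff_mul_le (Or.inl hpos) (Or.inl ENNReal.ofReal_ne_top)]
  refine le_of_forall_lt fun d hd => ?_
  -- The strict inequality `hlong` leaves room to keep `c` above `2 * C`.
  obtain ⟨c, hc1, hc2⟩ := exists_between (max_lt hd hlong)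
  have hctop : c ≠ ⊤ := hc2.ne_top
  rw [← ENNReal.ofReal_toReal hctop] at hc1 hc2
  have h2C : 2 * C ≤ c.toReal := by
    have := (le_max_right _ _).trans hc1.le
    exact (ENNReal.ofReal_le_ofReal_iff ENNReal.toReal_nonneg).1 this
  refine ((le_max_left _ _).trans_lt hc1).trans_le ?_
  rw [ENNReal.le_div_iff_mul_le (Or.inl hpos) (Or.inl ENNReal.ofReal_ne_top), mul_comm]
  exact key _ h2C hc2
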